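/- **Theorem (Quadratic growth in composite optimization).** Let $f\colon\mathbb R^m\to\mathbb R$ be convex and $C^1$, let $g\colon\mathbb R^n\to\overline{\mathbb R}$ be closed (lower semicontinuous) and convex with nonempty domain, let $A\colon\mathbb R^n\to\mathbb R^m$ be linear, and set $\varphi(x)=f(Ax)+g(x)$. Let $S$ be the set of minimizers of $\varphi$, assumed nonempty, and $\varphi^*=\inf\varphi$. Put $\Psi(y)=f^\star(y)+g^\star(-A^Ty)$, where $^\star$ denotes the Fenchel conjugate, and let $\bar y$ be an optimal solution of the dual problem $\sup_y\,-\Psi(y)$. Suppose that 1. $S$ is bounded; 2. (dual nondegeneracy) $0\in A^T(\operatorname{ri}\operatorname{dom}f^\star)+\operatorname{ri}\operatorname{dom}g^\star$, and (dual strict complementarity) $0\in\operatorname{ri}\partial\Psi(\bar y)$; 3. $f$ is firmly convex relative to $\bar y$ and $g$ is firmly convex relative to $-A^T\bar y$. Here $h$ is firmly convex relative to $v$ if, with $h_v(x)=h(x)-\langle v,x\rangle$, for every compact set $\mathcal X$ there is $\alpha>0$ with $h_v(x)\ge \inf h_v+\frac{\alpha}{2}\operatorname{dist}^2\bigl(x,(\partial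 h_v)^{-1}(0)\bigr)$ for all $x\in\mathcal X$. Then $\varphi$ grows quadratically: there are $\alpha,\nu>0$ such that $$\varphi(x)\ge\varphi^*+\tfrac{\alpha}{2}\operatorname{dist}^2(x,S)\qquad\text{whenever }\varphi(x)\le\varphi^*+\nu .$$ If moreover the gradient of $x\mapsto f(Ax)$ is Lipschitz continuous, then for every $t>0$ the prox-gradient error bound holds with some parameters $\gamma,\nu>0$: $$\operatorname{dist}(x,S)\le\gamma\,\|\mathcal G_t(x)\|\qquad\text{whenever }\varphi(x)\le\varphi^*+\nu,$$ where $\mathcal G_t(x)=t^{-1}\bigl(x-\operatorname{prox}_{tg}(x-tA^T\nabla f(Ax))\bigr)$ and $\operatorname{prox}_{tg}(x)=\operatorname{argmin}_y\{g(y)+\frac1{2t}\|y-x\|^2\}$. -/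

import Mathlib

open scoped Pointwise

noncomputable section

namespace CompositeOpt

section General

variable {E : Type*} [NormedAddCommGroup E] [InnerProductSpace ℝ E]

/-- The domain `{x | h x < +∞}` of an extended-real-valued function. -/
def dom (h : E → EReal) : Set E := {x | h x < ⊤}

/-- Convexity of an extended-real-valued function: its epigraph in `E × ℝ` is convex. -/
def IsConvex (h : E → EReal) : Prop := Convex ℝ {p : E × ℝ | h p.1 ≤ (p.2 : EReal)}

/-- The set of (global) minimizers. -/
def argmin (h : E → EReal) : Set E := {x | ∀ z, h x ≤ h z}

/-- The Fenchel conjugate `h⋆(y) = sup_x {⟨y, x⟩ - h x}`. -/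
def conj (h : E → EReal) (y : E) : EReal := ⨆ x, (((inner ℝ y x : ℝ) : EReal) - h x)

/-- The subdifferential `∂h(x)`: all `v` with `h z ≥ h x + ⟨v, z - x⟩` for every `z`. -/
def subdiff (h : E → EReal) (x : E) : Set E :=
  {v | ∀ z, h x + ((inner ℝ v (z - x) : ℝ) : EReal) ≤ h z}

/-- The tilted function `h_v(x) = h x - ⟨v, x⟩`. -/
def tilt (h : E → EReal) (v : E) (x : E) : EReal := h x - ((inner ℝ v x : ℝ) : EReal)

/-- Firm convexity relative to `v`: on every compact set `X` there is `α > 0` with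
`h_v(x) ≥ inf h_v + (α / 2) dist²(x, (∂h_v)⁻¹(0))`. The distance is the infimum of the distances
to the points of the set (so `+∞` for the empty set). -/
def FirmlyConvexAt (h : E → EReal) (v : E) : Prop :=
  ∀ X : Set E, IsCompact X → ∃ α : ℝ, 0 < α ∧ ∀ x ∈ X,
    (⨅ z, tilt h v z) +
        ((ENNReal.ofReal (α / 2) *
          Metric.infEDist x {u | (0 : E) ∈ subdiff (tilt h v) u} ^ 2 : ENNReal) : EReal)
      ≤ tilt h v x

/-- The sublevel set `[φ ≤ φ⋆ + ν]`, where `φ⋆ = inf φ`. -/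
def nearOptimal (φ : E → EReal) (ν : ℝ) : Set E := {x | φ x ≤ (⨅ z, φ z) + (ν : EReal)}

/-- Quadratic growth with parameters `(α, ν)` away from the minimizers `S` of `φ`:
`φ x ≥ φ⋆ + (α / 2) dist²(x, S)` on `[φ ≤ φ⋆ + ν]` (used when `S` is nonempty). -/
def QuadraticGrowth (φ : E → EReal) (α ν : ℝ) : Prop :=
  ∀ x ∈ nearOptimal φ ν,
    (⨅ z, φ z) + ((α / 2 * Metric.infDist x (argmin φ) ^ 2 : ℝ) : EReal) ≤ φ x

/-- The proximal map `prox_{tg}(x) = argmin_y {g y + ‖y - x‖² / (2t)}`. For `t > 0` and `g` closed,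
proper and convex on a finite-dimensional space there is exactly one minimizer, and this is it. -/
def prox (t : ℝ) (g : E → EReal) (x : E) : E :=
  Classical.epsilon fun p => p ∈ argmin fun y => g y + ((‖y - x‖ ^ 2 / (2 * t) : ℝ) : EReal)

/-- The prox-gradient mapping `𝒢_t(x) = t⁻¹ (x - prox_{tg}(x - t ∇F(x)))` of `F + g`. -/
def proxGrad [CompleteSpace E] (t : ℝ) (F : E → ℝ) (g : E → EReal) (x : E) : E :=
  t⁻¹ • (x - prox t g (x - t • gradient F x))

/-- The error bound condition with parameters `(γ, ν)` for `F + g` and step `t`: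
`dist(x, S) ≤ γ ‖𝒢_t(x)‖` on the sublevel set `[F + g ≤ inf (F + g) + ν]`,
where `S` is the set of minimizers of `F + g` (used when `S` is nonempty). -/
def ErrorBound [CompleteSpace E] (t : ℝ) (F : E → ℝ) (g : E → EReal) (γ ν : ℝ) : Prop :=
  ∀ x ∈ nearOptimal (fun z => (F z : EReal) + g z) ν,
    Metric.infDist x (argmin fun z => (F z : EReal) + g z) ≤ γ * ‖proxGrad t F g x‖

end General

section Composite

variable {E F : Type*} [NormedAddCommGroup E] [InnerProductSpace ℝ E] [CompleteSpace E]
  [NormedAddCommGroup F] [InnerProductSpace ℝ F] [CompleteSpace F]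

/-- The primal objective `φ(x) = f(Ax) + g(x)`. -/
def primal (f : F → ℝ) (g : E → EReal) (A : E →L[ℝ] F) (x : E) : EReal :=
  (f (A x) : EReal) + g x

/-- `Ψ(y) = f⋆(y) + g⋆(-Aᵀy)`; the Fenchel dual problem is `sup_y -Ψ(y)`. -/
def dualObj (f : F → ℝ) (g : E → EReal) (A : E →L[ℝ] F) (y : F) : EReal :=
  conj (fun z => (f z : EReal)) y + conj g (-(ContinuousLinearMap.adjoint A y))

/-- Dual nondegeneracy: `0 ∈ Aᵀ(ri dom f⋆) + ri dom g⋆`. -/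
def DualNondegenerate (f : F → ℝ) (g : E → EReal) (A : E →L[ℝ] F) : Prop :=
  (0 : E) ∈ ContinuousLinearMap.adjoint A ''
      intrinsicInterior ℝ (dom (conj fun z => (f z : EReal))) +
    intrinsicInterior ℝ (dom (conj g))

/-- Dual strict complementarity at `y`: `0 ∈ ri ∂Ψ(y)`. -/
def DualStrictComplementarity (f : F → ℝ) (g : E → EReal) (A : E →L[ℝ] F) (y : F) : Prop :=
  (0 : F) ∈ intrinsicInterior ℝ (subdiff (dualObj f g A) y)

end Composite

end CompositeOpt

end

namespace CompositeOpt

/-! ### Convex analysis of extended-real functions. -/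

section General

variable {E : Type*} [NormedAddCommGroup E] [InnerProductSpace ℝ E]

/-! Write `w = -Aᵀȳ`, `P = (∂f)⁻¹(ȳ)`, `Q = (∂g)⁻¹(w)`. Adding the two firm convexity inequalities,
the linear terms cancel, so on a ball `φ - φ⋆` dominates a multiple of `dist²(Ax, P) + dist²(x, Q)`.
Points of `Q ∩ A⁻¹P` are minimizers, so growth follows from the linear regularity `dist(x, Q ∩ A⁻¹P)
≤ κ (dist(Ax, P) + dist(x, Q))`.

Strict complementarity gives this regularity. Every `p - Aq` with `p ∈ P`, `q ∈ Q` lies in `∂Ψ(ȳ)`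
(`sub_mem_subdiff_dualObj`), and since `0 ∈ ri ∂Ψ(ȳ)` so do its small multiples of either sign. As
`S` is bounded, the primal problem perturbed by such a multiple has a solution in a fixed ball,
which writes it again as `p' - Ax'` (`mem_subdiff_of_mem_subdiff_dualObj`). Mixing `q` with the `x'`
of the opposite sign cancels the defect (`exists_linear_regularity`).

For the error bound, the prox-gradient point `q` carries a subgradient of `φ` of size `O(‖𝒢‖)`.
Convexity bounds the gap at `q` by that size times `dist(q, S)`, and quadratic growth turns this
into a bound on `dist(q, S)`. -/

theorem IsConvex.le_combo {h : E → EReal} (hh : IsConvex h) {x y : E} {a b s t : ℝ}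
    (hx : h x ≤ (a : EReal)) (hy : h y ≤ (b : EReal)) (hs : 0 ≤ s) (ht : 0 ≤ t)
    (hst : s + t = 1) : h (s • x + t • y) ≤ ((s * a + t * b : ℝ) : EReal) := by
  have := hh (x := (x, a)) hx (y := (y, b)) hy hs ht hst
  simpa using this

theorem isConvex_coe {f : E → ℝ} (hf : ConvexOn ℝ Set.univ f) :
    IsConvex (fun z => (f z : EReal)) := by
  have := hf.convex_epigraph
  simpa [IsConvex] using this

/-- Along a ray, a one-sided linear lower bound on the increments bounds the directional
derivative from below. -/
theorem le_inner_of_increment_ge [CompleteSpace E] {H : E → ℝ} {x y d : E} {c : ℝ}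
    (hH : HasGradientAt H y x)
    (h : ∀ t : ℝ, 0 < t → t ≤ 1 → t * c ≤ H (x + t • d) - H x) : c ≤ inner ℝ y d := by
  have h1 : HasDerivAt (fun t : ℝ => H (x + t • d)) (inner ℝ y d) 0 := by
    have h2 : HasDerivAt (fun t : ℝ => x + t • d) d 0 := by
      simpa using ((hasDerivAt_id (0 : ℝ)).smul_const d).const_add x
    have h3 : HasFDerivAt H (InnerProductSpace.toDual ℝ E y) (x + (0 : ℝ) • d) := by
      simpa using hH.hasFDerivAt
    simpa [Function.comp_def] using h3.comp_hasDerivAt (0 : ℝ) h2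
  have h4 := h1.tendsto_slope_zero_right
  refine ge_of_tendsto h4 ?_
  have : Set.Ioc (0 : ℝ) 1 ∈ nhdsWithin (0 : ℝ) (Set.Ioi 0) := Ioc_mem_nhdsGT one_pos
  filter_upwards [this] with t ht
  have := h t ht.1 ht.2
  simp only [zero_add, zero_smul, add_zero, smul_eq_mul]
  rw [inv_mul_eq_div, le_div_iff₀ ht.1]
  linarith

/-- Convexity of `g` bounds its increments along a segment linearly, so minimality forces a linear
lower bound on those of `H`, which passes to the derivative. `H` need not be convex. -/
theorem neg_mem_subdiff_of_mem_argmin_add [CompleteSpace E] {H : E → ℝ} {g : E → EReal} {x y : E}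
    (hH : HasGradientAt H y x) (hg : IsConvex g) (hbot : ∀ z, g z ≠ ⊥) (htop : g x ≠ ⊤)
    (hx : x ∈ argmin fun z => (H z : EReal) + g z) : -y ∈ subdiff g x := by
  intro z
  rcases eq_or_ne (g z) ⊤ with hz | hz
  · simp [hz]
  obtain ⟨a, ha⟩ : ∃ a : ℝ, g x = a := ⟨_, (EReal.coe_toReal htop (hbot x)).symm⟩
  obtain ⟨b, hb⟩ : ∃ b : ℝ, g z = b := ⟨_, (EReal.coe_toReal hz (hbot z)).symm⟩
  have key : a - b ≤ inner ℝ y (z - x) := by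
    refine le_inner_of_increment_ge hH fun t ht0 ht1 => ?_
    have h1 := hg.le_combo ha.le hb.le (sub_nonneg.2 ht1) ht0.le (by ring)
    have h2 : (1 - t) • x + t • z = x + t • (z - x) := by module
    rw [h2] at h1
    have h3 := (hx (x + t • (z - x))).trans (add_le_add_right h1 _)
    simp only [ha] at h3
    norm_cast at h3
    linarith
  rw [ha, hb, inner_neg_left]
  norm_cast
  linarith

theorem gradient_inequality [CompleteSpace E] {H : E → ℝ} {x y : E}
    (hH : HasGradientAt H y x) (hc : ConvexOn ℝ Set.univ H) (z : E) :
    H x + inner ℝ y (z - x) ≤ H z := by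
  have h1 : HasGradientAt (fun u => -H u) (-y) x := by
    rw [hasGradientAt_iff_hasFDerivAt, map_neg]
    exact hH.hasFDerivAt.neg
  have := le_inner_of_increment_ge (c := H x - H z) (d := z - x) h1 fun t ht0 ht1 => by
    have h2 := hc.2 (Set.mem_univ x) (Set.mem_univ z) (sub_nonneg.2 ht1) ht0.le (by ring)
    have h3 : (1 - t) • x + t • z = x + t • (z - x) := by module
    rw [h3] at h2
    simp only [smul_eq_mul] at h2
    linarith
  rw [inner_neg_left] at this
  linarith

theorem zero_mem_subdiff_tilt_iff {h : E → EReal} {v u : E} :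
    (0 : E) ∈ subdiff (tilt h v) u ↔ v ∈ subdiff h u := by
  refine forall_congr' fun z => ?_
  simp only [tilt, inner_zero_left, inner_sub_right]
  induction h u <;> induction h z <;> norm_num <;> norm_cast
  · simp only [EReal.coe_ne_bot]
  · constructor <;> intro <;> linarith
  · exact EReal.coe_ne_bot _
  · simp only [EReal.coe_ne_top, EReal.top_add_coe, top_le_iff]

theorem isClosed_setOf_mem_subdiff {h : E → EReal} (hh : LowerSemicontinuous h) (v : E) :
    IsClosed {u | v ∈ subdiff h u} := by
  have : {u | v ∈ subdiff h u} =
      ⋂ z, (fun u => h u + ((inner ℝ v (z - u) : ℝ) : EReal)) ⁻¹' Set.Iic (h z) := by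
    ext u; simp [subdiff]
  rw [this]
  refine isClosed_iInter fun z => LowerSemicontinuous.isClosed_preimage ?_ _
  refine hh.add' (Continuous.lowerSemicontinuous ?_) fun x => EReal.continuousAt_add ?_ ?_
  · exact continuous_coe_real_ereal.comp (by fun_prop)
  · simp
  · simp

theorem convex_setOf_mem_subdiff {h : E → EReal} (hh : IsConvex h) (hbot : ∀ z, h z ≠ ⊥) (v : E) :
    Convex ℝ {u | v ∈ subdiff h u} := by
  intro x hx y hy s t hs ht hst z
  rcases eq_or_ne (h z) ⊤ with hz | hz
  · simp [hz]
  obtain ⟨b, hb⟩ : ∃ b : ℝ, h z = b := ⟨_, (EReal.coe_toReal hz (hbot z)).symm⟩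
  have aux : ∀ u, v ∈ subdiff h u → h u ≤ ((b - inner ℝ v (z - u) : ℝ) : EReal) := by
    intro u hu
    have := hu z
    rw [hb] at this
    rw [EReal.coe_sub]
    exact EReal.le_sub_iff_add_le (by simp) (by simp) |>.2 this
  have h1 := hh.le_combo (aux x hx) (aux y hy) hs ht hst
  rw [hb]
  refine (add_le_add_left h1 _).trans ?_
  norm_cast
  simp only [inner_sub_right, inner_add_right, inner_smul_right]
  have : t = 1 - s := by linarith
  subst this
  apply le_of_eq
  ring

theorem mem_argmin_of_zero_mem_subdiff {h : E → EReal} {x : E} (hx : (0 : E) ∈ subdiff h x) :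
    x ∈ argmin h := fun z => by simpa using hx z

theorem iInf_eq_of_mem_argmin {h : E → EReal} {x : E} (hx : x ∈ argmin h) : ⨅ z, h z = h x :=
  le_antisymm (iInf_le _ _) (le_iInf hx)

/-- Real-valued form of firm convexity: a point `p` of the solution set attains the infimum of the
tilt and keeps the distance finite. -/
theorem FirmlyConvexAt.exists_growth {h : E → EReal} {v p : E} {a : ℝ} (hh : FirmlyConvexAt h v)
    (hp : v ∈ subdiff h p) (ha : h p = a) {X : Set E} (hX : IsCompact X) :
    ∃ α : ℝ, 0 < α ∧ ∀ x ∈ X,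
      ((a + inner ℝ v (x - p) + α / 2 * Metric.infDist x {u | v ∈ subdiff h u} ^ 2 : ℝ) : EReal)
        ≤ h x := by
  obtain ⟨α, hα, H⟩ := hh X hX
  refine ⟨α, hα, fun x hx => ?_⟩
  have h1 := H x hx
  simp only [zero_mem_subdiff_tilt_iff] at h1
  rw [iInf_eq_of_mem_argmin (mem_argmin_of_zero_mem_subdiff (zero_mem_subdiff_tilt_iff.2 hp))] at h1
  have hne : Metric.infEDist x {u | v ∈ subdiff h u} ≠ ⊤ := Metric.infEDist_ne_top ⟨p, hp⟩
  rw [← ENNReal.ofReal_toReal hne, ← ENNReal.ofReal_pow ENNReal.toReal_nonneg,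
    ← ENNReal.ofReal_mul (by positivity), EReal.coe_ennreal_ofReal, max_eq_left (by positivity)] at h1
  change _ + ((α / 2 * Metric.infDist x {u | v ∈ subdiff h u} ^ 2 : ℝ) : EReal) ≤ _ at h1
  simp only [tilt, ha] at h1
  induction hhx : h x with
  | bot => rw [hhx] at h1; norm_cast at h1
  | top => simp
  | coe b =>
    rw [hhx] at h1
    norm_cast at h1 ⊢
    rw [inner_sub_right]
    linarith

/-- A convex function exceeding a level on a sphere exceeds it outside of the sphere, if the level
is attained at the centre. -/
theorem IsConvex.lt_of_lt_on_sphere {h : E → EReal} (hh : IsConvex h) {x₀ : E} {c r : ℝ}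
    (hr : 0 < r) (h₀ : h x₀ ≤ (c : EReal)) (hs : ∀ x ∈ Metric.sphere x₀ r, (c : EReal) < h x)
    {x : E} (hx : x ∉ Metric.closedBall x₀ r) : (c : EReal) < h x := by
  by_contra! hcon
  simp only [Metric.mem_closedBall, not_le, dist_eq_norm] at hx
  have hpos : 0 < ‖x - x₀‖ := hr.trans hx
  set t := r / ‖x - x₀‖ with ht
  have ht1 : t ≤ 1 := (div_le_one hpos).2 hx.le
  have ht0 : 0 ≤ t := by positivity
  have h1 := hh.le_combo h₀ hcon (sub_nonneg.2 ht1) ht0 (by ring)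
  have h2 : (1 - t) • x₀ + t • x = x₀ + t • (x - x₀) := by module
  have h3 : (1 - t) * c + t * c = c := by ring
  rw [h2, h3] at h1
  refine absurd h1 (not_le.2 (hs _ ?_))
  simp [norm_smul, ht, hpos.ne', abs_of_pos hr]

/-- A sphere enclosing all minimizers is compact and contains none, so the minimum over it exceeds
the optimal value. -/
theorem exists_sphere_gap [ProperSpace E] {h : E → EReal} (hh : LowerSemicontinuous h) {x₀ : E}
    {c : ℝ} (hx₀ : x₀ ∈ argmin h) (hc : h x₀ = c) (hb : Bornology.IsBounded (argmin h)) :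
    ∃ r ε : ℝ, 0 < r ∧ 0 < ε ∧ ∀ x ∈ Metric.sphere x₀ r, ((c + ε : ℝ) : EReal) < h x := by
  obtain ⟨r, hr, hsub⟩ := hb.subset_ball_lt 0 x₀
  -- The sphere is empty in dimension zero.
  rcases (Metric.sphere x₀ r).eq_empty_or_nonempty with he | hne
  · exact ⟨r, 1, hr, one_pos, by simp [he]⟩
  obtain ⟨x₁, hx₁, hmin⟩ :=
    (hh.lowerSemicontinuousOn _).exists_isMinOn hne (isCompact_sphere x₀ r)
  have h1 : (c : EReal) < h x₁ := by
    by_contra! hcon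
    have : x₁ ∈ argmin h := fun z => (hcon.trans hc.ge).trans (hx₀ z)
    have := hsub this
    simp only [Metric.mem_sphere, Metric.mem_ball] at this hx₁
    linarith
  obtain ⟨b, hb1, hb2⟩ := EReal.lt_iff_exists_real_btwn.1 h1
  refine ⟨r, b - c, hr, sub_pos.2 (by exact_mod_cast hb1), fun x hx => ?_⟩
  rw [add_sub_cancel]
  exact hb2.trans_le (hmin hx)

theorem lowerSemicontinuous_coe_add {H : E → ℝ} {g : E → EReal} (hH : Continuous H)
    (hg : LowerSemicontinuous g) : LowerSemicontinuous fun x => (H x : EReal) + g x := by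
  refine (continuous_coe_real_ereal.comp hH).lowerSemicontinuous.add' hg fun x =>
    EReal.continuousAt_add ?_ ?_ <;> simp

theorem isConvex_coe_add {H : E → ℝ} {g : E → EReal} (hH : ConvexOn ℝ Set.univ H)
    (hg : IsConvex g) : IsConvex fun x => (H x : EReal) + g x := by
  have key : ∀ x (a : ℝ), (H x : EReal) + g x ≤ a ↔ g x ≤ ((a - H x : ℝ) : EReal) := by
    intro x a
    induction g x <;> norm_num <;> norm_cast
    · constructor <;> intro <;> linarith
    · exact EReal.coe_ne_top _
  rintro ⟨x, a⟩ hx ⟨y, b⟩ hy s t hs ht hst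
  have h1 := hg.le_combo ((key x a).1 hx) ((key y b).1 hy) hs ht hst
  have h2 := hH.2 (Set.mem_univ x) (Set.mem_univ y) hs ht hst
  refine (key _ _).2 (h1.trans ?_)
  simp only [smul_eq_mul] at h2
  norm_cast
  simp only [Prod.smul_mk, Prod.mk_add_mk, smul_eq_mul]
  linarith

end General

/-! ### Proximal points, and the error bound from quadratic growth. -/

section Prox

variable {E : Type*} [NormedAddCommGroup E] [InnerProductSpace ℝ E]

theorem hasGradientAt_sq_dist [CompleteSpace E] (t : ℝ) (x p : E) :
    HasGradientAt (fun y : E => ‖y - x‖ ^ 2 / (2 * t)) (t⁻¹ • (p - x)) p := by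
  rw [hasGradientAt_iff_hasFDerivAt]
  have h1 : HasFDerivAt (fun y : E => y - x) (ContinuousLinearMap.id ℝ E) p :=
    (hasFDerivAt_id p).sub_const x
  have h2 := h1.norm_sq.mul_const ((2 * t)⁻¹)
  simp only [← div_eq_mul_inv] at h2
  refine h2.congr_fderiv ?_
  ext v
  simp
  ring

/-- A closed function with a subgradient somewhere has a proximal point. -/
theorem exists_mem_argmin_prox [ProperSpace E] {g : E → EReal} (hg : LowerSemicontinuous g)
    {p v : E} (hv : v ∈ subdiff g p) {a : ℝ} (ha : g p = a) {t : ℝ} (ht : 0 < t) (x : E) :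
    (argmin fun y => g y + ((‖y - x‖ ^ 2 / (2 * t) : ℝ) : EReal)).Nonempty := by
  set h : E → EReal := fun y => g y + ((‖y - x‖ ^ 2 / (2 * t) : ℝ) : EReal) with hh
  have hlsc : LowerSemicontinuous h := by
    have := lowerSemicontinuous_coe_add (H := fun y => ‖y - x‖ ^ 2 / (2 * t)) (by fun_prop) hg
    simpa only [add_comm] using this
  -- Beyond `‖p - x‖ + 2t‖v‖` the quadratic term outweighs the affine minorant of `g` given by `v`;
  -- the extra `‖p - x‖` is slack.
  set R : ℝ := 2 * ‖p - x‖ + 2 * t * ‖v‖ with hR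
  have hpos : 0 ≤ R := by positivity
  obtain ⟨q, hq, hmin⟩ := (hlsc.lowerSemicontinuousOn _).exists_isMinOn
    (s := Metric.closedBall x R) ⟨x, by simpa using hpos⟩ (isCompact_closedBall x R)
  have hpR : p ∈ Metric.closedBall x R := by
    rw [Metric.mem_closedBall, dist_eq_norm, hR]
    have := norm_nonneg (p - x)
    have : 0 ≤ 2 * t * ‖v‖ := by positivity
    linarith
  refine ⟨q, fun z => ?_⟩
  by_cases hz : z ∈ Metric.closedBall x R
  · exact hmin hz
  refine (hmin hpR).trans ?_
  rw [Metric.mem_closedBall, dist_eq_norm, not_le] at hz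
  refine le_trans ?_ (add_le_add_left (hv z) _)
  simp only [hh, ha]
  norm_cast
  have h1 : -(‖v‖ * (‖z - x‖ + ‖p - x‖)) ≤ inner ℝ v (z - p) := by
    have h2 := (abs_le.1 (abs_real_inner_le_norm v (z - p))).1
    have h3 : ‖z - p‖ ≤ ‖z - x‖ + ‖p - x‖ := by
      simpa using norm_sub_le (z - x) (p - x)
    have := mul_le_mul_of_nonneg_left h3 (norm_nonneg v)
    linarith
  have h4 : ‖p - x‖ ^ 2 / (2 * t) + ‖v‖ * (‖z - x‖ + ‖p - x‖) ≤ ‖z - x‖ ^ 2 / (2 * t) := by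
    rw [← sub_nonneg]
    have : ‖z - x‖ ^ 2 / (2 * t) - (‖p - x‖ ^ 2 / (2 * t) + ‖v‖ * (‖z - x‖ + ‖p - x‖)) =
      (‖z - x‖ + ‖p - x‖) * (‖z - x‖ - ‖p - x‖ - 2 * t * ‖v‖) / (2 * t) := by
      field_simp
      ring
    rw [this]
    have := norm_nonneg (p - x)
    have : 0 ≤ ‖z - x‖ - ‖p - x‖ - 2 * t * ‖v‖ := by linarith
    positivity
  linarith

theorem prox_optimality [ProperSpace E] {g : E → EReal} (hg : LowerSemicontinuous g)
    (hconv : IsConvex g) (hbot : ∀ z, g z ≠ ⊥)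
    {p v : E} (hv : v ∈ subdiff g p) {a : ℝ} (ha : g p = a) {t : ℝ} (ht : 0 < t) (x : E) :
    t⁻¹ • (x - prox t g x) ∈ subdiff g (prox t g x) ∧ g (prox t g x) ≠ ⊤ := by
  have h1 : prox t g x ∈ argmin fun y => g y + ((‖y - x‖ ^ 2 / (2 * t) : ℝ) : EReal) :=
    Classical.epsilon_spec (exists_mem_argmin_prox hg hv ha ht x)
  have h2 : g (prox t g x) ≠ ⊤ := by
    intro htop
    have := h1 p
    simp only [htop, ha, EReal.top_add_coe, top_le_iff] at this
    exact EReal.coe_ne_top _ (by exact_mod_cast this)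
  refine ⟨?_, h2⟩
  have h3 : -(t⁻¹ • (prox t g x - x)) ∈ subdiff g (prox t g x) := by
    refine neg_mem_subdiff_of_mem_argmin_add (hasGradientAt_sq_dist t x _) hconv hbot h2 ?_
    simpa only [add_comm] using h1
  rwa [← smul_neg, neg_sub] at h3

theorem QuadraticGrowth.exists_errorBound [ProperSpace E] {F : E → ℝ} {g : E → EReal}
    (hF : Differentiable ℝ F) (hFc : ConvexOn ℝ Set.univ F)
    (hg : LowerSemicontinuous g) (hconv : IsConvex g) (hbot : ∀ z, g z ≠ ⊥)
    {x₀ : E} (hx₀ : x₀ ∈ argmin fun z => (F z : EReal) + g z) (htop : g x₀ ≠ ⊤)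
    {α ν : ℝ} (hα : 0 < α) (hν : 0 < ν)
    (hgrow : QuadraticGrowth (fun z => (F z : EReal) + g z) α ν)
    {β : NNReal} (hβ : LipschitzWith β (gradient F)) {t : ℝ} (ht : 0 < t) :
    ∃ γ ν : ℝ, 0 < γ ∧ 0 < ν ∧ ErrorBound t F g γ ν := by
  obtain ⟨a, ha⟩ : ∃ a : ℝ, g x₀ = a := ⟨_, (EReal.coe_toReal htop (hbot x₀)).symm⟩
  set S := argmin fun z => (F z : EReal) + g z with hS
  have hinf : (⨅ z, ((F z : EReal) + g z)) = ((F x₀ + a : ℝ) : EReal) := by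
    rw [iInf_eq_of_mem_argmin hx₀, ha]; rfl
  have hgrad : ∀ x, HasGradientAt F (gradient F x) x := fun x => (hF x).hasGradientAt
  have hsub₀ := neg_mem_subdiff_of_mem_argmin_add (hgrad x₀) hconv hbot htop hx₀
  -- growth and sublevel sets in terms of real numbers
  have hgrow' : ∀ x (b : ℝ), g x = b → F x + b ≤ F x₀ + a + ν →
      F x₀ + a + α / 2 * Metric.infDist x S ^ 2 ≤ F x + b := by
    intro x b hb hle
    have h1 : x ∈ nearOptimal (fun z => (F z : EReal) + g z) ν := by
      simp only [nearOptimal, Set.mem_ofPred_eq, hinf, hb]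
      exact_mod_cast hle
    have := hgrow x h1
    simp only [hinf, hb] at this
    exact_mod_cast this
  set D : ℝ := √(2 * ν / α) with hD
  have hDbound : ∀ x ∈ nearOptimal (fun z => (F z : EReal) + g z) ν, Metric.infDist x S ≤ D := by
    intro x hx
    simp only [nearOptimal, Set.mem_ofPred_eq, hinf] at hx
    have hxt : g x ≠ ⊤ := by
      intro h
      rw [h, EReal.coe_add_top, top_le_iff] at hx
      exact EReal.coe_ne_top (F x₀ + a + ν) (by exact_mod_cast hx)
    obtain ⟨b, hb⟩ : ∃ b : ℝ, g x = b := ⟨_, (EReal.coe_toReal hxt (hbot x)).symm⟩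
    rw [hb] at hx
    have hx' : F x + b ≤ F x₀ + a + ν := by exact_mod_cast hx
    have := hgrow' x b hb hx'
    refine Real.le_sqrt_of_sq_le ?_
    rw [le_div_iff₀ hα]
    linarith
  have hD0 : 0 ≤ D := Real.sqrt_nonneg _
  -- The subgradient `u` at `q` is `𝒢` plus a gradient difference over a step of length `t‖𝒢‖`.
  set κ : ℝ := 1 + t * β with hκ
  have hκ0 : 0 < κ := by positivity
  -- a step is either short, and then lands in the sublevel set, or long
  set η : ℝ := min 1 (ν / (κ * (D + t))) with hη
  have hDt : 0 < D + t := by linarith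
  have hη0 : 0 < η := lt_min one_pos (by positivity)
  -- `t` pays for moving from `x` to `q`, `2κ/α` for `dist(q, S)`, and `D/η` for long steps.
  refine ⟨t + 2 / α * κ + D / η, ν, by positivity, hν, fun x hx => ?_⟩
  have hDx := hDbound x hx
  set G := proxGrad t F g x with hG
  change Metric.infDist x S ≤ _
  have hGn : 0 ≤ ‖G‖ := norm_nonneg G
  rcases le_or_gt η ‖G‖ with hlong | hshort
  · have h1 : D ≤ D / η * ‖G‖ := by
      rw [div_mul_eq_mul_div, le_div_iff₀ hη0]
      exact mul_le_mul_of_nonneg_left hlong hD0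
    have h2 : 0 ≤ (t + 2 / α * κ) * ‖G‖ := by positivity
    calc _ ≤ D := hDx
      _ ≤ _ := by rw [add_mul]; linarith
  set q := prox t g (x - t • gradient F x) with hq
  obtain ⟨hopt, hqtop⟩ := prox_optimality hg hconv hbot hsub₀ ha ht (x - t • gradient F x)
  rw [← hq] at hopt hqtop
  obtain ⟨b, hb⟩ : ∃ b : ℝ, g q = b := ⟨_, (EReal.coe_toReal hqtop (hbot q)).symm⟩
  have hxq : x - q = t • G := by
    rw [hG, proxGrad, smul_smul, mul_inv_cancel₀ ht.ne', one_smul]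
  have hopt' : G - gradient F x ∈ subdiff g q := by
    convert hopt using 1
    have : x - t • gradient F x - q = t • (G - gradient F x) := by
      rw [smul_sub, ← hxq]; abel
    rw [this, smul_smul, inv_mul_cancel₀ ht.ne', one_smul]
  set u := G - gradient F x + gradient F q with hu
  have hun : ‖u‖ ≤ κ * ‖G‖ := by
    have h1 : u = G + (gradient F q - gradient F x) := by rw [hu]; abel
    have h2 := hβ.dist_le_mul q x
    rw [dist_eq_norm, dist_eq_norm, norm_sub_rev q x, hxq, norm_smul, Real.norm_of_nonneg ht.le] at h2
    rw [h1]
    refine (norm_add_le _ _).trans ?_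
    rw [hκ]
    linarith
  have hdist : dist x q = t * ‖G‖ := by
    rw [dist_eq_norm, hxq, norm_smul, Real.norm_of_nonneg ht.le]
  have hq1 : Metric.infDist q S ≤ Metric.infDist x S + t * ‖G‖ := by
    rw [← hdist, dist_comm]
    exact Metric.infDist_le_infDist_add_dist
  have hq2 : Metric.infDist x S ≤ Metric.infDist q S + t * ‖G‖ := by
    rw [← hdist]
    exact Metric.infDist_le_infDist_add_dist
  have hgap : F q + b - (F x₀ + a) ≤ ‖u‖ * Metric.infDist q S := by
    -- The distance is only approached; the slack `e / (‖u‖ + 1)` costs at most `e` after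
    -- multiplication by `‖u‖`.
    refine le_of_forall_pos_le_add fun e he => ?_
    obtain ⟨z, hz, hzd⟩ := (Metric.infDist_lt_iff (s := S) ⟨x₀, hx₀⟩).1
      (show Metric.infDist q S < Metric.infDist q S + e / (‖u‖ + 1) by
        have : 0 < e / (‖u‖ + 1) := by positivity
        linarith)
    have h1 := hopt' z
    have h2 := gradient_inequality (hgrad q) hFc z
    have h3 := hz x₀
    simp only [ha] at h3
    have hztop : g z ≠ ⊤ := by
      intro h
      rw [h, EReal.coe_add_top, top_le_iff] at h3
      exact EReal.coe_ne_top (F x₀ + a) (by exact_mod_cast h3)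
    obtain ⟨c, hc⟩ : ∃ c : ℝ, g z = c := ⟨_, (EReal.coe_toReal hztop (hbot z)).symm⟩
    rw [hc] at h3
    rw [hc, hb] at h1
    norm_cast at h1 h3
    have h4 : inner ℝ u (z - q) =
        inner ℝ (G - gradient F x) (z - q) + inner ℝ (gradient F q) (z - q) := by
      rw [hu, inner_add_left]
    have h5 := (abs_le.1 (abs_real_inner_le_norm u (z - q))).1
    have h6 : ‖u‖ * ‖z - q‖ ≤ ‖u‖ * (Metric.infDist q S + e / (‖u‖ + 1)) := by
      rw [norm_sub_rev, ← dist_eq_norm]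
      exact mul_le_mul_of_nonneg_left hzd.le (norm_nonneg u)
    have h7 : ‖u‖ * (e / (‖u‖ + 1)) ≤ e := by
      rw [mul_div_assoc', div_le_iff₀ (by positivity)]
      nlinarith [norm_nonneg u]
    rw [mul_add] at h6
    linarith
  have hqd0 : 0 ≤ Metric.infDist q S := Metric.infDist_nonneg
  -- The two entries of `η` serve here: `‖𝒢‖ ≤ 1` gives `dist(q, S) ≤ D + t`, and the other bounds
  -- the gap `κ‖𝒢‖(D + t)` by `ν`.
  have hnear : F q + b ≤ F x₀ + a + ν := by
    have h1 : ‖G‖ ≤ 1 := hshort.le.trans (min_le_left _ _)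
    have h2 : κ * ‖G‖ * (D + t) ≤ ν := by
      have := hshort.le.trans (min_le_right _ _)
      rw [le_div_iff₀ (by positivity)] at this
      linarith
    have h3 : Metric.infDist q S ≤ D + t := by
      have := mul_le_mul_of_nonneg_left h1 ht.le
      linarith
    have h4 := mul_le_mul hun h3 hqd0 (by positivity)
    linarith
  have h1 := hgrow' q b hb hnear
  have h2 : Metric.infDist q S ≤ 2 / α * κ * ‖G‖ := by
    rcases hqd0.eq_or_lt with h | h
    · rw [← h]; positivity
    have h3 : α / 2 * Metric.infDist q S ≤ ‖u‖ := by
      refine le_of_mul_le_mul_right ?_ h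
      linarith
    have h4 : Metric.infDist q S = 2 / α * (α / 2 * Metric.infDist q S) := by
      field_simp
    rw [h4, mul_assoc (2 / α)]
    exact mul_le_mul_of_nonneg_left (h3.trans hun) (by positivity)
  have h3 : 0 ≤ D / η * ‖G‖ := by positivity
  rw [add_mul, add_mul]
  linarith

end Prox

/-! ### Duality, linear regularity and quadratic growth. -/

section Composite

variable {E F : Type*} [NormedAddCommGroup E] [InnerProductSpace ℝ E]
  [NormedAddCommGroup F] [InnerProductSpace ℝ F]

theorem ne_bot_of_dom_conj_nonempty {g : E → EReal} (h : (dom (conj g)).Nonempty) (z : E) :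
    g z ≠ ⊥ := by
  obtain ⟨y, hy⟩ := h
  intro hz
  have h1 : ((inner ℝ y z : ℝ) : EReal) - g z ≤ conj g y :=
    le_iSup (fun x => ((inner ℝ y x : ℝ) : EReal) - g x) z
  rw [hz, EReal.coe_sub_bot, top_le_iff] at h1
  exact hy.ne h1

theorem le_conj {h : E → EReal} {x : E} {a : ℝ} (ha : h x = a) (y : E) :
    ((inner ℝ y x - a : ℝ) : EReal) ≤ conj h y := by
  refine le_trans (le_of_eq ?_) (le_iSup (fun x => ((inner ℝ y x : ℝ) : EReal) - h x) x)
  rw [ha]; rfl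

theorem conj_le_of_mem_subdiff {h : E → EReal} {x y : E} {a : ℝ} (ha : h x = a)
    (hy : y ∈ subdiff h x) : conj h y ≤ ((inner ℝ y x - a : ℝ) : EReal) := by
  refine iSup_le fun z => ?_
  have h1 := hy z
  rw [ha, inner_sub_right] at h1
  induction hz : h z with
  | bot => rw [hz] at h1; norm_cast at h1
  | top => simp
  | coe b =>
    rw [hz] at h1
    norm_cast at h1 ⊢
    linarith

theorem mem_subdiff_coe_iff {f : F → ℝ} {v x : F} :
    v ∈ subdiff (fun z => (f z : EReal)) x ↔ ∀ z, f x + inner ℝ v (z - x) ≤ f z :=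
  forall_congr' fun z => by
    rw [← EReal.coe_add, EReal.coe_le_coe_iff]

/-- Perturbing the argument of `f` slightly keeps the composite objective above its central value
on a sphere. -/
theorem exists_perturbed_sphere_gap [ProperSpace E] {f : F → ℝ} (hf : Continuous f)
    {g : E → EReal} (A : E →L[ℝ] F) {x₀ : E} {a : ℝ} {r ε : ℝ} (hr : 0 < r)
    (hε : 0 < ε)
    (hs : ∀ x ∈ Metric.sphere x₀ r, ((f (A x₀) + a + ε : ℝ) : EReal) < (f (A x) : EReal) + g x) :
    ∃ δ : ℝ, 0 < δ ∧ ∀ v : F, ‖v‖ ≤ δ → ∀ x ∈ Metric.sphere x₀ r,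
      ((f (A x₀ + v) + a : ℝ) : EReal) < (f (A x + v) : EReal) + g x := by
  -- Half of the gap is spent at `x`, half at the centre.
  have h1 : ∀ᶠ v in nhds (0 : F), ∀ x ∈ Metric.closedBall x₀ r,
      |f (A x + v) - f (A x)| < ε / 2 := by
    refine (isCompact_closedBall x₀ r).eventually_forall_of_forall_eventually
      (P := fun v x => |f (A x + v) - f (A x)| < ε / 2) fun x _ => ?_
    have hc : Continuous fun z : F × E => |f (A z.2 + z.1) - f (A z.2)| := by fun_prop
    refine hc.continuousAt.eventually_lt continuousAt_const ?_
    simpa using hε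
  obtain ⟨δ, hδ, hball⟩ := Metric.eventually_nhds_iff.1 h1
  refine ⟨δ / 2, by positivity, fun v hv x hx => ?_⟩
  have h2 := hball (y := v) (by rw [dist_zero_right]; linarith)
  have h3 := abs_lt.1 (h2 x (Metric.sphere_subset_closedBall hx))
  have h4 := abs_lt.1 (h2 x₀ (by simpa using hr.le))
  have h5 := hs x hx
  induction hgx : g x with
  | bot => rw [hgx] at h5; simp at h5
  | top =>
    rw [EReal.coe_add_top]
    exact EReal.coe_lt_top _
  | coe b =>
    rw [hgx] at h5
    norm_cast at h5 ⊢
    linarith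

/-- A point at which both Fenchel–Young equalities hold gives a subgradient of the dual
objective. -/
theorem sub_mem_subdiff_dualObj [ProperSpace E] [ProperSpace F]
    {f : F → ℝ} {g : E → EReal} {A : E →L[ℝ] F} {ybar p : F} {q : E}
    {b : ℝ} (hb : g q = b) (hp : ybar ∈ subdiff (fun z => (f z : EReal)) p)
    (hq : -(ContinuousLinearMap.adjoint A ybar) ∈ subdiff g q) :
    p - A q ∈ subdiff (dualObj f g A) ybar := by
  intro y
  have h1 := conj_le_of_mem_subdiff (h := fun z => (f z : EReal)) (a := f p) rfl hp
  have h2 := conj_le_of_mem_subdiff hb hq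
  have h3 := le_conj (h := fun z => (f z : EReal)) (x := p) (a := f p) rfl y
  have h4 := le_conj hb (-(ContinuousLinearMap.adjoint A y))
  refine (add_le_add_left (add_le_add h1 h2) _).trans (le_trans ?_ (add_le_add h3 h4))
  norm_cast
  simp only [inner_neg_left, ContinuousLinearMap.adjoint_inner_left, inner_sub_left,
    inner_sub_right]
  rw [real_inner_comm ybar p, real_inner_comm y p, real_inner_comm ybar (A q),
    real_inner_comm y (A q)]
  linarith

/-- Dual subgradients are attained: if the perturbed primal problem has a solution `x`, then a
subgradient `v` of the dual objective has the form `p - A x`. -/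
theorem mem_subdiff_of_mem_subdiff_dualObj [ProperSpace E] [ProperSpace F]
    {f : F → ℝ} (hfc : ConvexOn ℝ Set.univ f)
    (hfd : Differentiable ℝ f) {g : E → EReal} (hconv : IsConvex g) (hbot : ∀ z, g z ≠ ⊥)
    {A : E →L[ℝ] F} {ybar v : F} (hv : v ∈ subdiff (dualObj f g A) ybar) {x : E} {b : ℝ}
    (hb : g x = b) (hx : x ∈ argmin fun z => (f (A z + v) : EReal) + g z) :
    ybar ∈ subdiff (fun z => (f z : EReal)) (A x + v) ∧
      -(ContinuousLinearMap.adjoint A ybar) ∈ subdiff g x := by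
  set y := gradient f (A x + v) with hy
  have hgrad : HasGradientAt f y (A x + v) := (hfd _).hasGradientAt
  have hH : HasGradientAt (fun z => f (A z + v)) (ContinuousLinearMap.adjoint A y) x := by
    rw [hasGradientAt_iff_hasFDerivAt]
    have h1 : HasFDerivAt (fun z => A z + v) A x := A.hasFDerivAt.add_const v
    refine (hgrad.hasFDerivAt.comp x h1).congr_fderiv ?_
    ext u
    simp [ContinuousLinearMap.adjoint_inner_left]
  have h1 := neg_mem_subdiff_of_mem_argmin_add hH hconv hbot (by simp [hb]) hx
  have h2 : y ∈ subdiff (fun z => (f z : EReal)) (A x + v) :=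
    mem_subdiff_coe_iff.2 (gradient_inequality hgrad hfc)
  -- Testing at `y = ∇f(Ax + v)`, where both Fenchel–Young equalities hold, bounds `Ψ(ȳ)` above by
  -- the Fenchel–Young terms of `ȳ` at `(Ax + v, x)`. These are then jointly maximal, and freezing
  -- one argument at a time separates the two conclusions.
  have h3 := hv y
  have h4 : dualObj f g A y ≤ _ := add_le_add
    (conj_le_of_mem_subdiff (h := fun z => (f z : EReal)) (a := f (A x + v)) rfl h2)
    (conj_le_of_mem_subdiff hb h1)
  have key : ∀ (z : F) (u : E) (c : ℝ), g u = c →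
      inner ℝ ybar z - f z + (inner ℝ (-(ContinuousLinearMap.adjoint A ybar)) u - c) ≤
        inner ℝ ybar (A x + v) - f (A x + v) +
          (inner ℝ (-(ContinuousLinearMap.adjoint A ybar)) x - b) := by
    intro z u c hc
    have h5 : _ ≤ dualObj f g A ybar := add_le_add
      (le_conj (h := fun z => (f z : EReal)) (x := z) (a := f z) rfl ybar)
      (le_conj hc (-(ContinuousLinearMap.adjoint A ybar)))
    have h6 := (add_le_add_left h5 _).trans (h3.trans h4)
    norm_cast at h6
    simp only [inner_neg_left, ContinuousLinearMap.adjoint_inner_left, inner_add_right,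
      inner_sub_right] at h6 ⊢
    rw [real_inner_comm y v, real_inner_comm ybar v] at h6
    linarith
  constructor
  · refine mem_subdiff_coe_iff.2 fun z => ?_
    have := key z x b hb
    rw [inner_sub_right]
    linarith
  · intro u
    rw [hb]
    induction hu : g u with
    | bot => exact absurd hu (hbot u)
    | top => simp
    | coe c =>
      have := key (A x + v) u c hu
      rw [inner_sub_right]
      norm_cast
      linarith

/-- The perturbed primal problem is solvable in a ball, for a convex objective exceeding the
central value on the boundary sphere. -/
theorem exists_mem_argmin_of_sphere [ProperSpace E]
    {h : E → EReal} (hh : LowerSemicontinuous h)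
    (hconv : IsConvex h) {x₀ : E} {c r : ℝ} (hr : 0 < r) (h₀ : h x₀ = c)
    (hs : ∀ x ∈ Metric.sphere x₀ r, (c : EReal) < h x) :
    ∃ x ∈ Metric.closedBall x₀ r, x ∈ argmin h := by
  have hmem : x₀ ∈ Metric.closedBall x₀ r := by simpa using hr.le
  obtain ⟨q, hq, hmin⟩ := (hh.lowerSemicontinuousOn _).exists_isMinOn
    (s := Metric.closedBall x₀ r) ⟨x₀, hmem⟩ (isCompact_closedBall x₀ r)
  refine ⟨q, hq, fun z => ?_⟩
  by_cases hz : z ∈ Metric.closedBall x₀ r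
  · exact hmin hz
  · exact (hmin hmem).trans (h₀.le.trans (hconv.lt_of_lt_on_sphere hr h₀.le hs hz).le)

/-- Since `0 ∈ D`, the affine span is a linear subspace and contains all multiples of `v`, negative
ones included. -/
theorem exists_neg_smul_mem_of_zero_mem_intrinsicInterior {D : Set F}
    (h0 : (0 : F) ∈ intrinsicInterior ℝ D) :
    ∃ δ : ℝ, 0 < δ ∧ ∀ v ∈ D, ∀ c : ℝ, ‖c • v‖ < δ → c • v ∈ D := by
  obtain ⟨y, hy, hy0⟩ := mem_intrinsicInterior.1 h0
  obtain ⟨δ, hδ, hball⟩ := Metric.mem_nhds_iff.1 (mem_interior_iff_mem_nhds.1 hy)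
  refine ⟨δ, hδ, fun v hv c hc => ?_⟩
  have h0D : (0 : F) ∈ affineSpan ℝ D := hy0 ▸ y.2
  have h1 : c • v ∈ affineSpan ℝ D := by
    have := AffineMap.lineMap_mem c h0D (subset_affineSpan ℝ D hv)
    simpa [AffineMap.lineMap_apply] using this
  have h2 : (⟨c • v, h1⟩ : affineSpan ℝ D) ∈ Metric.ball y δ := by
    rw [Metric.mem_ball, Subtype.dist_eq, hy0, dist_zero_right]
    exact hc
  exact hball h2

/-- Linear regularity of `Q ∩ A⁻¹ P`: if small multiples of `p - A q` for `p ∈ P`, `q ∈ Q` are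
again differences of this kind, with `q` in a fixed ball. -/
theorem exists_linear_regularity [ProperSpace E] [ProperSpace F]
    {P : Set F} {Q : Set E} {A : E →L[ℝ] F} (hP : Convex ℝ P)
    (hQ : Convex ℝ Q) (hPc : IsClosed P) (hQc : IsClosed Q) {x₀ : E} (hx₀Q : x₀ ∈ Q)
    (hx₀P : A x₀ ∈ P) {δ r : ℝ} (hδ : 0 < δ) (hr : 0 < r)
    (H : ∀ p ∈ P, ∀ q ∈ Q, ∀ c : ℝ, ‖c • (p - A q)‖ ≤ δ →
      ∃ x ∈ Metric.closedBall x₀ r, x ∈ Q ∧ A x + c • (p - A q) ∈ P) :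
    ∃ κ : ℝ, 0 < κ ∧ ∀ x ∈ Metric.closedBall x₀ r,
      Metric.infDist x (Q ∩ A ⁻¹' P) ≤ κ * (Metric.infDist (A x) P + Metric.infDist x Q) := by
  refine ⟨1 + 3 * r / δ * (1 + ‖A‖), by positivity, fun x hx => ?_⟩
  obtain ⟨q, hq, hxq⟩ := hQc.exists_infDist_eq_dist ⟨x₀, hx₀Q⟩ x
  obtain ⟨p, hp, hxp⟩ := hPc.exists_infDist_eq_dist ⟨_, hx₀P⟩ (A x)
  set v := p - A q with hv
  have hvn : ‖v‖ ≤ dist (A x) p + ‖A‖ * dist x q := by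
    have h1 : v = (p - A x) + A (x - q) := by rw [hv, map_sub]; abel
    rw [h1, dist_comm, dist_eq_norm, dist_eq_norm]
    exact (norm_add_le _ _).trans (add_le_add_right (A.le_opNorm _) _)
  have hd1 : 0 ≤ dist (A x) p := dist_nonneg
  have hd2 : 0 ≤ dist x q := dist_nonneg
  have hA : 0 ≤ ‖A‖ := norm_nonneg A
  rw [hxq, hxp]
  rcases eq_or_ne v 0 with h0 | h0
  · have hqS : q ∈ Q ∩ A ⁻¹' P := by
      refine ⟨hq, ?_⟩
      have : p = A q := sub_eq_zero.1 h0
      rwa [Set.mem_preimage, ← this]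
    have h1 := Metric.infDist_le_dist_of_mem (x := x) hqS
    have h2 : 0 ≤ 3 * r / δ * (1 + ‖A‖) * (dist (A x) p + dist x q) := by positivity
    rw [add_mul, one_mul]
    linarith
  have hvpos : 0 < ‖v‖ := norm_pos_iff.2 h0
  -- The defect opposite to `v`, of the full length `δ`; the weight `l` below makes `(1 - l)v` and
  -- `l(δ/‖v‖)v` cancel.
  obtain ⟨x₁, hx₁, hx₁Q, hx₁P⟩ := H p hp q hq (-(δ / ‖v‖)) (by
    rw [← hv, norm_smul, norm_neg, Real.norm_of_nonneg (by positivity), div_mul_cancel₀ _ hvpos.ne'])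
  rw [← hv] at hx₁P
  set l := ‖v‖ / (δ + ‖v‖) with hl
  have hl0 : 0 ≤ l := by positivity
  have hl1 : l ≤ 1 := (div_le_one (by positivity)).2 (by linarith)
  have hzQ := hQ hq hx₁Q (sub_nonneg.2 hl1) hl0 (by ring)
  have hzP := hP hp hx₁P (sub_nonneg.2 hl1) hl0 (by ring)
  have hz : (1 - l) • p + l • (A x₁ + -(δ / ‖v‖) • v) = A ((1 - l) • q + l • x₁) := by
    have h1 : p = A q + v := by rw [hv]; abel
    have h2 : (1 - l) - l * (δ / ‖v‖) = 0 := by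
      rw [hl]
      field_simp
      ring
    rw [h1, map_add, map_smul, map_smul]
    have h3 : (1 - l) • (A q + v) + l • (A x₁ + -(δ / ‖v‖) • v) =
      (1 - l) • A q + l • A x₁ + ((1 - l) - l * (δ / ‖v‖)) • v := by module
    rw [h3, h2, zero_smul, add_zero]
  rw [hz] at hzP
  have h1 := Metric.infDist_le_dist_of_mem (x := x)
    (show (1 - l) • q + l • x₁ ∈ Q ∩ A ⁻¹' P from ⟨hzQ, hzP⟩)
  have h2 : dist x ((1 - l) • q + l • x₁) ≤ dist x q + l * dist q x₁ := by
    refine (dist_triangle x q _).trans (add_le_add_right (le_of_eq ?_) _)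
    have : q - ((1 - l) • q + l • x₁) = l • (q - x₁) := by module
    rw [dist_eq_norm, dist_eq_norm, this, norm_smul, Real.norm_of_nonneg hl0]
  -- As `x₀ ∈ Q`, the projection `q` is no farther from `x` than `x₀` is.
  have h3 : dist q x₁ ≤ 3 * r := by
    have h4 : dist x q ≤ dist x x₀ := hxq ▸ Metric.infDist_le_dist_of_mem hx₀Q
    rw [Metric.mem_closedBall] at hx hx₁
    have h5 := dist_triangle4 q x x₀ x₁
    rw [dist_comm q x, dist_comm x₀ x₁] at h5
    linarith
  have h4 : l ≤ ‖v‖ / δ := div_le_div_of_nonneg_left hvpos.le hδ (by linarith)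
  have h5 : l * dist q x₁ ≤ 3 * r / δ * ‖v‖ := by
    refine (mul_le_mul h4 h3 dist_nonneg (by positivity)).trans (le_of_eq ?_)
    ring
  have h6 : ‖v‖ ≤ (1 + ‖A‖) * (dist (A x) p + dist x q) := by nlinarith
  have h7 := mul_le_mul_of_nonneg_left h6 (show 0 ≤ 3 * r / δ by positivity)
  rw [add_mul, one_mul, mul_assoc (3 * r / δ)]
  linarith

theorem exists_quadraticGrowth [ProperSpace E] [ProperSpace F]
    {f : F → ℝ} {g : E → EReal} {A : E →L[ℝ] F}
    (hfc : ConvexOn ℝ Set.univ f) (hfd : Differentiable ℝ f)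
    (hconv : IsConvex g) (hg : LowerSemicontinuous g) (hbot : ∀ z, g z ≠ ⊥)
    {x₀ : E} (hx₀ : x₀ ∈ argmin (primal f g A)) (htop : g x₀ ≠ ⊤)
    (hbdd : Bornology.IsBounded (argmin (primal f g A)))
    {ybar : F} (hstrict : DualStrictComplementarity f g A ybar)
    (hf_firm : FirmlyConvexAt (fun z => (f z : EReal)) ybar)
    (hg_firm : FirmlyConvexAt g (-(ContinuousLinearMap.adjoint A ybar))) :
    ∃ α ν : ℝ, 0 < α ∧ 0 < ν ∧ QuadraticGrowth (primal f g A) α ν := by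
  obtain ⟨a, ha⟩ : ∃ a : ℝ, g x₀ = a := ⟨_, (EReal.coe_toReal htop (hbot x₀)).symm⟩
  set w := -(ContinuousLinearMap.adjoint A ybar) with hw
  have hfcont : Continuous f := hfd.continuous
  have hshift : ∀ v, ConvexOn ℝ Set.univ fun z => f (A z + v) := fun v => by
    have h1 := (hfc.translate_left v).comp_linearMap A.toLinearMap
    simpa [Function.comp_def] using h1
  have hφlsc : ∀ v, LowerSemicontinuous fun z => (f (A z + v) : EReal) + g z := fun v =>
    lowerSemicontinuous_coe_add (by fun_prop) hg
  have hφconv : ∀ v, IsConvex fun z => (f (A z + v) : EReal) + g z := fun v =>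
    isConvex_coe_add (hshift v) hconv
  have hφ0 : (fun z => (f (A z + 0) : EReal) + g z) = primal f g A := by
    funext z; simp [primal]
  have hlsc0 : LowerSemicontinuous (primal f g A) := hφ0 ▸ hφlsc 0
  have hconv0 : IsConvex (primal f g A) := hφ0 ▸ hφconv 0
  have hval : primal f g A x₀ = ((f (A x₀) + a : ℝ) : EReal) := by rw [primal, ha]; rfl
  obtain ⟨r, ε, hr, hε, hgap⟩ := exists_sphere_gap hlsc0 hx₀ hval hbdd
  obtain ⟨δ, hδ, hδgap⟩ := exists_perturbed_sphere_gap hfcont A hr hε hgap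
  obtain ⟨δ', hδ', hri⟩ := exists_neg_smul_mem_of_zero_mem_intrinsicInterior hstrict
  have h0D : (0 : F) ∈ subdiff (dualObj f g A) ybar := intrinsicInterior_subset hstrict
  have fin : ∀ {v : F} {x : E}, x ∈ argmin (fun z => (f (A z + v) : EReal) + g z) →
      ∃ b : ℝ, g x = b := by
    intro v x hx
    have h1 := hx x₀
    simp only [ha] at h1
    refine ⟨_, (EReal.coe_toReal (fun h => ?_) (hbot x)).symm⟩
    rw [h, EReal.coe_add_top, top_le_iff] at h1
    exact EReal.coe_ne_top (f (A x₀ + v) + a) (by exact_mod_cast h1)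
  set P := {z : F | ybar ∈ subdiff (fun z => (f z : EReal)) z} with hP
  set Q := {x : E | w ∈ subdiff g x} with hQ
  have hx₀' : x₀ ∈ argmin (fun z => (f (A z + 0) : EReal) + g z) := by rwa [hφ0]
  obtain ⟨hx₀P, hx₀Q⟩ := mem_subdiff_of_mem_subdiff_dualObj hfc hfd hconv hbot h0D ha hx₀'
  rw [add_zero] at hx₀P
  have hQtop : ∀ q ∈ Q, ∃ b : ℝ, g q = b := by
    intro q hq
    refine ⟨_, (EReal.coe_toReal (fun h => ?_) (hbot q)).symm⟩
    have h1 := hq x₀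
    rw [h, ha, EReal.top_add_coe, top_le_iff] at h1
    exact EReal.coe_ne_top a h1
  have hsplit : ∀ x, inner ℝ ybar (A x - A x₀) + inner ℝ w (x - x₀) = 0 := by
    intro x
    rw [hw, inner_neg_left, ContinuousLinearMap.adjoint_inner_left, map_sub, add_neg_cancel]
  -- points satisfying both optimality conditions are minimizers
  have hsub : Q ∩ A ⁻¹' P ⊆ argmin (primal f g A) := by
    rintro x ⟨hxQ, hxP⟩ z
    refine le_trans ?_ (hx₀ z)
    obtain ⟨b, hb⟩ := hQtop x hxQ
    have h1 := mem_subdiff_coe_iff.1 hxP (A x₀)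
    have h2 := hxQ x₀
    have h3 := hsplit x
    rw [hb, ha] at h2
    rw [hval, primal, hb]
    rw [← neg_sub x x₀, inner_neg_right] at h2
    rw [← neg_sub (A x) (A x₀), inner_neg_right] at h1
    norm_cast at h2 ⊢
    linarith
  obtain ⟨κ, hκ, hreg⟩ := exists_linear_regularity (P := P) (Q := Q) (A := A)
    (convex_setOf_mem_subdiff (isConvex_coe hfc) (by simp) ybar)
    (convex_setOf_mem_subdiff hconv hbot w)
    (isClosed_setOf_mem_subdiff (continuous_coe_real_ereal.comp hfcont).lowerSemicontinuous ybar)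
    (isClosed_setOf_mem_subdiff hg w) hx₀Q hx₀P (δ := min δ (δ' / 2))
    -- Halving `δ'` turns the weak norm bound into the strict one required by the relative interior.
    (lt_min hδ (by positivity)) hr (by
      intro p hp q hq c hc
      obtain ⟨b, hb⟩ := hQtop q hq
      have h1 : c • (p - A q) ∈ subdiff (dualObj f g A) ybar := by
        refine hri _ (sub_mem_subdiff_dualObj hb hp hq) c ?_
        have := hc.trans (min_le_right _ _)
        linarith
      obtain ⟨x, hxball, hx⟩ := exists_mem_argmin_of_sphere (hφlsc (c • (p - A q)))
        (hφconv (c • (p - A q))) hr (by rw [ha]; rfl) (hδgap _ (hc.trans (min_le_left _ _)))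
      obtain ⟨d, hd⟩ := fin hx
      have := mem_subdiff_of_mem_subdiff_dualObj hfc hfd hconv hbot h1 hd hx
      exact ⟨x, hxball, this.2, this.1⟩)
  have hball := isCompact_closedBall x₀ r
  obtain ⟨α₁, hα₁, hf1⟩ := hf_firm.exists_growth hx₀P (a := f (A x₀)) rfl
    (hball.image A.continuous)
  obtain ⟨α₂, hα₂, hg1⟩ := hg_firm.exists_growth hx₀Q ha hball
  have hα : 0 < min α₁ α₂ := lt_min hα₁ hα₂
  -- `κ²` comes from squaring the regularity bound, the `2` from `(d₁ + d₂)² ≤ 2(d₁² + d₂²)`. With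
  -- `ν = ε` the sublevel set stays inside the ball.
  refine ⟨min α₁ α₂ / (2 * κ ^ 2), ε, by positivity, hε, fun x hx => ?_⟩
  rw [nearOptimal, Set.mem_ofPred_eq, iInf_eq_of_mem_argmin hx₀, hval] at hx
  have hxball : x ∈ Metric.closedBall x₀ r := by
    by_contra hcon
    have h1 := hconv0.lt_of_lt_on_sphere hr (c := f (A x₀) + a + ε)
      (hval.le.trans (by norm_cast; linarith)) hgap hcon
    exact absurd h1 (not_lt.2 (by exact_mod_cast hx))
  rw [iInf_eq_of_mem_argmin hx₀, hval]
  have h1 := hf1 (A x) ⟨x, hxball, rfl⟩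
  have h2 := hg1 x hxball
  have h3 := hreg x hxball
  have h4 : Metric.infDist x (argmin (primal f g A)) ≤ Metric.infDist x (Q ∩ A ⁻¹' P) :=
    Metric.infDist_le_infDist_of_subset hsub ⟨x₀, hx₀Q, hx₀P⟩
  have h5 := hsplit x
  rw [primal]
  induction hgx : g x with
  | bot => exact absurd hgx (hbot x)
  | top => simp
  | coe b =>
    rw [hgx] at h2
    change ((f (A x₀) + inner ℝ ybar (A x - A x₀) + α₁ / 2 * Metric.infDist (A x) P ^ 2 : ℝ) :
      EReal) ≤ _ at h1
    change ((a + inner ℝ w (x - x₀) + α₂ / 2 * Metric.infDist x Q ^ 2 : ℝ) : EReal) ≤ _ at h2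
    norm_cast at h1 h2 ⊢
    set d₁ := Metric.infDist (A x) P
    set d₂ := Metric.infDist x Q
    have h6 : Metric.infDist x (argmin (primal f g A)) ^ 2 ≤ (κ * (d₁ + d₂)) ^ 2 :=
      pow_le_pow_left₀ Metric.infDist_nonneg (h4.trans h3) 2
    have h7 : min α₁ α₂ / (2 * κ ^ 2) / 2 * Metric.infDist x (argmin (primal f g A)) ^ 2 ≤
        min α₁ α₂ / 4 * (d₁ + d₂) ^ 2 := by
      refine (mul_le_mul_of_nonneg_left h6 (by positivity)).trans (le_of_eq ?_)
      field_simp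
      ring
    have h8 : min α₁ α₂ / 4 * (d₁ + d₂) ^ 2 ≤ min α₁ α₂ / 2 * (d₁ ^ 2 + d₂ ^ 2) := by
      have := mul_nonneg hα.le (sq_nonneg (d₁ - d₂))
      linarith
    have h9 := mul_le_mul_of_nonneg_right (min_le_left α₁ α₂) (sq_nonneg d₁)
    have h10 := mul_le_mul_of_nonneg_right (min_le_right α₁ α₂) (sq_nonneg d₂)
    linarith

end Composite

end CompositeOpt

theorem mainTheorem7 {n m : ℕ}
    (f : EuclideanSpace ℝ (Fin m) → ℝ) (g : EuclideanSpace ℝ (Fin n) → EReal)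
    (A : EuclideanSpace ℝ (Fin n) →L[ℝ] EuclideanSpace ℝ (Fin m))
    (hf_convex : ConvexOn ℝ Set.univ f) (hf_smooth : ContDiff ℝ 1 f)
    (hg_convex : CompositeOpt.IsConvex g) (hg_closed : LowerSemicontinuous g)
    (hg_proper : (CompositeOpt.dom g).Nonempty)
    (hS_nonempty : (CompositeOpt.argmin (CompositeOpt.primal f g A)).Nonempty)
    (hS_bounded : Bornology.IsBounded (CompositeOpt.argmin (CompositeOpt.primal f g A)))
    (hnondeg : CompositeOpt.DualNondegenerate f g A)
    (ybar : EuclideanSpace ℝ (Fin m))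
    (hybar : ybar ∈ CompositeOpt.argmin (CompositeOpt.dualObj f g A))
    (hstrict : CompositeOpt.DualStrictComplementarity f g A ybar)
    (hf_firm : CompositeOpt.FirmlyConvexAt (fun z => (f z : EReal)) ybar)
    (hg_firm : CompositeOpt.FirmlyConvexAt g (-(ContinuousLinearMap.adjoint A ybar))) :
    (∃ α ν : ℝ, 0 < α ∧ 0 < ν ∧
      CompositeOpt.QuadraticGrowth (CompositeOpt.primal f g A) α ν) ∧
    (∀ β : NNReal, LipschitzWith β (gradient fun x => f (A x)) →
      ∀ t : ℝ, 0 < t → ∃ γ ν : ℝ, 0 < γ ∧ 0 < ν ∧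
        CompositeOpt.ErrorBound t (fun x => f (A x)) g γ ν) := by
  have hfd : Differentiable ℝ f := hf_smooth.differentiable one_ne_zero
  -- Nondegeneracy provides a point where `g⋆` is not `⊤`, hence an affine minorant of `g`.
  have hbot : ∀ z, g z ≠ ⊥ := by
    obtain ⟨_, _, y, hy, _⟩ := Set.mem_add.1 hnondeg
    exact CompositeOpt.ne_bot_of_dom_conj_nonempty ⟨y, intrinsicInterior_subset hy⟩
  obtain ⟨x₀, hx₀⟩ := hS_nonempty
  have htop : g x₀ ≠ ⊤ := by
    obtain ⟨z, hz⟩ := hg_proper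
    intro h
    have h1 := hx₀ z
    rw [CompositeOpt.primal, h, EReal.coe_add_top, top_le_iff] at h1
    exact (EReal.add_lt_top (EReal.coe_ne_top _) (ne_of_lt hz)).ne h1
  obtain ⟨α, ν, hα, hν, hgrow⟩ := CompositeOpt.exists_quadraticGrowth hf_convex hfd hg_convex
    hg_closed hbot hx₀ htop hS_bounded hstrict hf_firm hg_firm
  refine ⟨⟨α, ν, hα, hν, hgrow⟩, fun β hβ t ht => ?_⟩
  have hFd : Differentiable ℝ fun x => f (A x) := hfd.comp A.differentiable
  have hFc : ConvexOn ℝ Set.univ fun x => f (A x) := hf_convex.comp_linearMap A.toLinearMap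
  exact hgrow.exists_errorBound hFd hFc hg_closed hg_convex hbot hx₀ htop hα hν hβ ht
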